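/- For $n\ge 1$ and compact intervals $[\underline{x}_i,\overline{x}_i]$, $i=1,\dots,n$, with centers $x_i^*=\tfrac12(\underline{x}_i+\overline{x}_i)$ and radii $x_i^\Delta=\tfrac12(\overline{x}_i-\underline{x}_i)$, the \emph{FGKLA intersection graph} is the graph on $\{1,\dots,n\}$ in which $i\neq j$ are adjacent if and only if the narrowed intervals $[x_i^*-\tfrac1n x_i^\Delta,\ x_i^*+\tfrac1n x_i^\Delta]$ and $[x_j^*-\tfrac1n x_j^\Delta,\ x_j^*+\tfrac1n x_j^\Delta]$ intersect. Let $\omega$ be the size of its largest clique. Let $L>0$, $0<\varepsilon\le 1$ and $\gamma\in\mathbb{R}$. Suppose that (A) the centers $x_1^*,\dots,x_n^*$ are i.i.d. real random variables whose c.d.f. $\Phi^*$ satisfies $\Phi^*(\tilde z)-\Phi^*(z)\le L(\tilde z-z)$ whenever $\tilde z>z$; (B) the radii $x_1^\Delta,\dots,x_n^\Delta$ are i.i.d. (almost surely) nonnegative random variables with $\mathsf{E}[(x_i^\Delta)^{1+\varepsilon}]=\gamma<\infty$; (C) the random vectors $(x_1^*,\dots,x_n^*)$ and $(x_1^\Delta,\dots,x_n^\Delta)$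 are independent. Then, with $\log=\ln$ the natural logarithm: (a) there is $n_0$, depending only on $L,\varepsilon,\gamma$, such that for all $n\ge n_0$ $$\mathsf{E}\,2^\omega\le 1+2n^{1/\log\log n}\qquad\text{and}\qquad \mathsf{E}\,\omega\le \tfrac32\Bigl(1+\frac{\log n}{\log\log n}\Bigr);$$ (b) for every $\delta>0$ there is $n_1$, depending only on $\delta,L,\varepsilon,\gamma$, such that for all $n\ge n_1$ $$\Pr[\omega\ge\delta n]\le e^{-n\ln\ln n}.$$ -/

import Mathlib

open MeasureTheory ProbabilityTheory

noncomputable section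

/-- Center `x*ᵢ` of the compact interval `[lo i, hi i]`. -/
def intervalCenter {n : ℕ} (lo hi : Fin n → ℝ) (i : Fin n) : ℝ := (lo i + hi i) / 2

/-- Radius `xᐞᵢ` of the compact interval `[lo i, hi i]`. -/
def intervalRadius {n : ℕ} (lo hi : Fin n → ℝ) (i : Fin n) : ℝ := (hi i - lo i) / 2

/-- The narrowed interval: `[lo i, hi i]` shrunk by the factor `n` around its center. -/
def narrowedInterval {n : ℕ} (lo hi : Fin n → ℝ) (i : Fin n) : Set ℝ :=
  Set.Icc (intervalCenter lo hi i - 1 / (n : ℝ) * intervalRadius lo hi i)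
    (intervalCenter lo hi i + 1 / (n : ℝ) * intervalRadius lo hi i)

/-- The FGKLA intersection graph with data `[lo 1, hi 1], …, [lo n, hi n]`: distinct indices are
adjacent iff the corresponding narrowed intervals intersect. -/
def fgklaGraph {n : ℕ} (lo hi : Fin n → ℝ) : SimpleGraph (Fin n) where
  Adj i j := i ≠ j ∧ (narrowedInterval lo hi i ∩ narrowedInterval lo hi j).Nonempty
  symm := ⟨fun _ _ h => ⟨h.1.symm, by rw [Set.inter_comm]; exact h.2⟩⟩
  loopless := ⟨fun _ h => h.1 rfl⟩

/-- The clique number (size of a largest clique) of the FGKLA intersection graph whose data are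
the intervals with centers `c` and radii `r`. -/
def fgklaOmega {n : ℕ} (c r : Fin n → ℝ) : ℕ :=
  (fgklaGraph (fun i => c i - r i) (fun i => c i + r i)).cliqueNum

/-- The probabilistic model: the centers `X i` are i.i.d. with an `L`-Lipschitz c.d.f., the radii
`R i` are i.i.d., (almost surely) nonnegative, with finite moment of order `1 + ε` equal to `γ`,
and the sample of centers is independent of the sample of radii. -/
structure IntervalModel {Ω : Type*} [MeasurableSpace Ω] (P : Measure Ω) {n : ℕ}
    (X R : Fin n → Ω → ℝ) (L ε γ : ℝ) : Prop where
  measurable_center : ∀ i, Measurable (X i)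
  measurable_radius : ∀ i, Measurable (R i)
  indep_center : iIndepFun X P
  identDistrib_center : ∀ i j, IdentDistrib (X i) (X j) P P
  cdf_lipschitz : ∀ i, ∀ z z' : ℝ, z < z' →
    cdf (P.map (X i)) z' - cdf (P.map (X i)) z ≤ L * (z' - z)
  indep_radius : iIndepFun R P
  identDistrib_radius : ∀ i j, IdentDistrib (R i) (R j) P P
  radius_nonneg : ∀ i, ∀ᵐ ω ∂P, 0 ≤ R i ω
  integrable_moment : ∀ i, Integrable (fun ω => R i ω ^ (1 + ε)) P
  moment_eq : ∀ i, ∫ ω, R i ω ^ (1 + ε) ∂P = γ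
  indep_center_radius : IndepFun (fun ω i => X i ω) (fun ω i => R i ω) P

end

open scoped ENNReal
open Filter Topology

/-! In a clique on `m + 1` vertices, let `i` have the smallest radius. Every other center lies
within `2 * r j / n` of `c i`. Bounding by `r j` rather than `r i` is what matters: given the radii
and `c i`, the Lipschitz c.d.f. makes these `m` independent events have probability at most `4 * L *
r j / n`, and averaging over independent radii needs only first moments. With `C = 4 * L * (1 +
|γ|)`, each choice of clique and `i` costs `(C / n) ^ m`. A union bound gives `P(m + 1 ≤ ω) ≤ n * C
^ m / m!` (`measureReal_succ_le_fgklaOmega_le`). The factorial overtakes `n` near `m = log n / log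
log n`, which gives both expectations; at `m ≈ δ n` it gives decay of order `exp (-δ n log n)`,
stronger than (b). -/

/-! ### Clustering of independent centers -/

lemma measure_Icc_le_of_cdf_lipschitz (μ : Measure ℝ) [IsProbabilityMeasure μ] {L : ℝ}
    (hL : 0 ≤ L) (h : ∀ z z' : ℝ, z < z' → cdf μ z' - cdf μ z ≤ L * (z' - z)) (a b : ℝ) :
    μ (Set.Icc a b) ≤ ENNReal.ofReal (L * (b - a)) := by
  rcases lt_or_ge b a with hab | hab
  · simp [Set.Icc_eq_empty (not_le.2 hab)]
  -- The c.d.f. measures half-open intervals, so the left endpoint is pushed out by `η` to catch a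
  -- possible atom at `a`.
  have key : ∀ η : ℝ, 0 < η → μ.real (Set.Icc a b) ≤ L * (b - a) + L * η := by
    intro η hη
    have h1 : μ (Set.Icc a b) ≤ ENNReal.ofReal (cdf μ b - cdf μ (a - η)) := by
      rw [← StieltjesFunction.measure_Ioc, measure_cdf]
      exact measure_mono fun x hx => ⟨by linarith [hx.1], hx.2⟩
    have h2 := h (a - η) b (by linarith)
    have h3 := ENNReal.toReal_mono ENNReal.ofReal_ne_top h1
    rw [ENNReal.toReal_ofReal (sub_nonneg.2 (monotone_cdf μ (by linarith)))] at h3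
    exact h3.trans (h2.trans_eq (by ring))
  have : μ.real (Set.Icc a b) ≤ L * (b - a) := by
    refine le_of_forall_pos_le_add fun δ hδ => ?_
    refine (key (δ / (L + 1)) (by positivity)).trans ?_
    have : L * (δ / (L + 1)) ≤ δ := by
      rw [← mul_div_assoc, div_le_iff₀ (by positivity)]; nlinarith
    linarith
  rw [← ENNReal.ofReal_toReal (measure_ne_top μ (Set.Icc a b))]
  exact ENNReal.ofReal_le_ofReal this

/-- Fubini for the product law. It is used to freeze first the radii, then the center of smallest
radius. -/
lemma measure_mem_eq_lintegral_of_indepFun {Ω E F : Type*} [MeasurableSpace Ω]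
    [MeasurableSpace E] [MeasurableSpace F] {P : Measure Ω} [IsProbabilityMeasure P]
    {U : Ω → E} {V : Ω → F} (hU : Measurable U) (hV : Measurable V) (h : IndepFun U V P)
    {A : Set (E × F)} (hA : MeasurableSet A) :
    P {ω | (U ω, V ω) ∈ A} = ∫⁻ ω', P {ω | (U ω, V ω') ∈ A} ∂P := by
  have := Measure.isProbabilityMeasure_map (μ := P) hU.aemeasurable
  have := Measure.isProbabilityMeasure_map (μ := P) hV.aemeasurable
  have h1 := (indepFun_iff_map_prod_eq_prod_map_map hU.aemeasurable hV.aemeasurable).1 h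
  have h2 : P {ω | (U ω, V ω) ∈ A} = P.map (fun ω => (U ω, V ω)) A :=
    (Measure.map_apply (hU.prodMk hV) hA).symm
  rw [h2, h1, Measure.prod_apply_symm hA, lintegral_map (measurable_measure_prodMk_right hA) hV]
  refine lintegral_congr fun ω' => ?_
  rw [Measure.map_apply hU (measurable_prodMk_right hA)]
  rfl

/-- Independent points with Lipschitz c.d.f. clustering around one of them. -/
lemma measure_near_le {Ω ι : Type*} [MeasurableSpace Ω] [Fintype ι] [DecidableEq ι]
    {P : Measure Ω} [IsProbabilityMeasure P] {X : ι → Ω → ℝ} (hX : ∀ i, Measurable (X i))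
    (hind : iIndepFun X P) {L : ℝ} (hL : 0 ≤ L)
    (hcdf : ∀ i, ∀ z z' : ℝ, z < z' →
      cdf (P.map (X i)) z' - cdf (P.map (X i)) z ≤ L * (z' - z))
    (T : Finset ι) {i : ι} (hi : i ∉ T) (t : ι → ℝ) :
    P {ω | ∀ j ∈ T, |X j ω - X i ω| ≤ t j} ≤ ∏ j ∈ T, ENNReal.ofReal (2 * L * t j) := by
  have hI := (hind.indepFun_finset T {i} (by simpa using hi) hX)
  have hI' : IndepFun (fun ω (j : T) => X j ω) (X i) P :=
    hI.comp (φ := id) (ψ := fun f : (({i} : Finset ι) → ℝ) => f ⟨i, by simp⟩)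
      measurable_id (measurable_pi_apply _)
  have hA : MeasurableSet {p : (T → ℝ) × ℝ | ∀ j : T, |p.1 j - p.2| ≤ t j} := by
    rw [Set.ofPred_forall]
    refine MeasurableSet.iInter fun j => ?_
    exact measurableSet_le (by fun_prop) measurable_const
  have h1 := measure_mem_eq_lintegral_of_indepFun (measurable_pi_lambda _ fun j => hX _) (hX i)
    hI' hA
  have h2 : {ω | ∀ j ∈ T, |X j ω - X i ω| ≤ t j} =
      {ω | ((fun j : T => X j ω), X i ω) ∈
        {p : (T → ℝ) × ℝ | ∀ j : T, |p.1 j - p.2| ≤ t j}} := by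
    ext ω; simp
  rw [h2, h1]
  calc _ ≤ ∫⁻ _, ∏ j ∈ T, ENNReal.ofReal (2 * L * t j) ∂P := by
        refine lintegral_mono fun ω' => ?_
        have h3 : {ω | ((fun j : T => X j ω), X i ω') ∈
            {p : (T → ℝ) × ℝ | ∀ j : T, |p.1 j - p.2| ≤ t j}} =
            ⋂ j ∈ T, X j ⁻¹' Set.Icc (X i ω' - t j) (X i ω' + t j) := by
          ext ω
          simp only [Set.mem_ofPred_eq, Subtype.forall, Set.mem_iInter, Set.mem_preimage,
            Set.mem_Icc, abs_le]
          exact forall₂_congr fun j _ => by constructor <;> rintro ⟨h, h'⟩ <;> constructor <;> linarith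
        rw [h3, hind.measure_inter_preimage_eq_mul T (fun j _ => measurableSet_Icc)]
        refine Finset.prod_le_prod' fun j _ => ?_
        have := Measure.isProbabilityMeasure_map (μ := P) (hX j).aemeasurable
        rw [← Measure.map_apply (hX j) measurableSet_Icc]
        refine (measure_Icc_le_of_cdf_lipschitz _ hL (hcdf j) _ _).trans_eq ?_
        congr 1; ring
    _ = _ := by simp

/-! ### Cliques and measurability of the clique number -/

lemma fgklaGraph_adj_iff {n : ℕ} (c r : Fin n → ℝ) (i j : Fin n) :
    (fgklaGraph (fun i => c i - r i) (fun i => c i + r i)).Adj i j ↔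
      i ≠ j ∧ (c i - r i / n ≤ c i + r i / n ∧ c i - r i / n ≤ c j + r j / n) ∧
        c j - r j / n ≤ c i + r i / n ∧ c j - r j / n ≤ c j + r j / n := by
  have h (k : Fin n) : narrowedInterval (fun i => c i - r i) (fun i => c i + r i) k =
      Set.Icc (c k - r k / n) (c k + r k / n) := by
    simp only [narrowedInterval, intervalCenter, intervalRadius]
    congr 1 <;> ring
  simp only [fgklaGraph, h, Set.Icc_inter_Icc, Set.nonempty_Icc, sup_le_iff, le_inf_iff]
  tauto

lemma abs_sub_le_of_fgklaGraph_adj {n : ℕ} {c r : Fin n → ℝ} {i j : Fin n}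
    (h : (fgklaGraph (fun i => c i - r i) (fun i => c i + r i)).Adj i j) (hr : r i ≤ r j) :
    |c j - c i| ≤ 2 * r j / n := by
  obtain ⟨-, h1, h2⟩ := (fgklaGraph_adj_iff c r i j).1 h
  have : r i / n ≤ r j / n := by gcongr
  rw [abs_le, mul_div_assoc]
  constructor <;> linarith

/-- The witness `i` is a vertex of smallest radius in a clique `S`. Only star-shaped information
about `S` is kept, which suffices for the union bound. -/
lemma exists_near_of_le_fgklaOmega {n : ℕ} {c r : Fin n → ℝ} {m : ℕ}
    (h : m + 1 ≤ fgklaOmega c r) :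
    ∃ S ∈ (Finset.univ : Finset (Fin n)).powersetCard (m + 1), ∃ i ∈ S,
      ∀ j ∈ S.erase i, |c j - c i| ≤ 2 * r j / n := by
  obtain ⟨s, hs⟩ :=
    (fgklaGraph (fun i => c i - r i) (fun i => c i + r i)).exists_isNClique_cliqueNum
  obtain ⟨S, hSs, hS⟩ := Finset.exists_subset_card_eq (h.trans_eq hs.card_eq.symm)
  obtain ⟨i, hi, hmin⟩ := S.exists_min_image r (Finset.card_pos.1 (by omega))
  refine ⟨S, by simp [hS], i, hi, fun j hj => ?_⟩
  rw [Finset.mem_erase] at hj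
  exact abs_sub_le_of_fgklaGraph_adj
    (hs.isClique (hSs hi) (hSs hj.2) hj.1.symm) (hmin j hj.2)

lemma fgklaOmega_le {n : ℕ} (c r : Fin n → ℝ) : fgklaOmega c r ≤ n := by
  obtain ⟨s, hs⟩ :=
    (fgklaGraph (fun i => c i - r i) (fun i => c i + r i)).exists_isNClique_cliqueNum
  have := s.card_le_univ
  rw [hs.card_eq, Fintype.card_fin] at this
  exact this

lemma le_fgklaOmega_iff {n : ℕ} (c r : Fin n → ℝ) (k : ℕ) :
    k ≤ fgklaOmega c r ↔ ∃ S ∈ (Finset.univ : Finset (Fin n)).powersetCard k,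
      ∀ i ∈ S, ∀ j ∈ S, i ≠ j →
        (fgklaGraph (fun i => c i - r i) (fun i => c i + r i)).Adj i j := by
  constructor
  · intro h
    obtain ⟨s, hs⟩ :=
      (fgklaGraph (fun i => c i - r i) (fun i => c i + r i)).exists_isNClique_cliqueNum
    obtain ⟨S, hSs, hS⟩ := Finset.exists_subset_card_eq (h.trans_eq hs.card_eq.symm)
    exact ⟨S, by simp [hS], fun i hi j hj hij => hs.isClique (hSs hi) (hSs hj) hij⟩
  · rintro ⟨S, hS, hadj⟩
    rw [← (Finset.mem_powersetCard.1 hS).2]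
    exact SimpleGraph.IsClique.card_le_cliqueNum
      (tc := fun i hi j hj hij => hadj i hi j hj hij)

lemma measurable_fgklaOmega {Ω : Type*} [MeasurableSpace Ω] {n : ℕ} {X R : Fin n → Ω → ℝ}
    (hX : ∀ i, Measurable (X i)) (hR : ∀ i, Measurable (R i)) :
    Measurable fun ω => fgklaOmega (X · ω) (R · ω) := by
  refine measurable_of_Ici fun k => ?_
  have : (fun ω => fgklaOmega (X · ω) (R · ω)) ⁻¹' Set.Ici k =
      ⋃ S ∈ (Finset.univ : Finset (Fin n)).powersetCard k, ⋂ i ∈ S, ⋂ j ∈ S,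
        {ω | i ≠ j → (fgklaGraph (fun i => X i ω - R i ω) (fun i => X i ω + R i ω)).Adj i j} := by
    ext ω
    simp only [Set.mem_preimage, Set.mem_Ici, le_fgklaOmega_iff, Set.mem_iUnion, Set.mem_iInter,
      Set.mem_ofPred_eq, exists_prop]
  rw [this]
  refine Finset.measurableSet_biUnion _ fun S _ => Finset.measurableSet_biInter _ fun i _ =>
    Finset.measurableSet_biInter _ fun j _ => ?_
  by_cases hij : i = j
  · simp [hij]
  simp only [fgklaGraph_adj_iff, hij, ne_eq, not_false_eq_true, true_and, true_imp_iff,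
    Set.ofPred_and]
  refine .inter (.inter ?_ ?_) (.inter ?_ ?_) <;>
  exact measurableSet_le (by fun_prop) (by fun_prop)

/-! ### First moment method -/

/-- Pointwise, `y ≤ 1 + y ^ (1 + ε)` for `y ≥ 0`. -/
lemma lintegral_ofReal_le_of_moment {Ω : Type*} [MeasurableSpace Ω] {P : Measure Ω}
    [IsProbabilityMeasure P] {Y : Ω → ℝ} {ε γ : ℝ} (hε : 0 < ε) (hY : ∀ᵐ ω ∂P, 0 ≤ Y ω)
    (hint : Integrable (fun ω => Y ω ^ (1 + ε)) P) (hγ : ∫ ω, Y ω ^ (1 + ε) ∂P = γ) :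
    ∫⁻ ω, ENNReal.ofReal (Y ω) ∂P ≤ ENNReal.ofReal (1 + γ) := by
  have h0 : 0 ≤ᵐ[P] fun ω => 1 + Y ω ^ (1 + ε) := by
    filter_upwards [hY] with ω hω
    have := Real.rpow_nonneg hω (1 + ε)
    simp only [Pi.zero_apply]; linarith
  calc ∫⁻ ω, ENNReal.ofReal (Y ω) ∂P ≤ ∫⁻ ω, ENNReal.ofReal (1 + Y ω ^ (1 + ε)) ∂P := by
        refine lintegral_mono_ae ?_
        filter_upwards [hY] with ω hω
        refine ENNReal.ofReal_le_ofReal ?_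
        rcases le_total (Y ω) 1 with h1 | h1
        · linarith [Real.rpow_nonneg hω (1 + ε)]
        · linarith [Real.self_le_rpow_of_one_le h1 (by linarith : 1 ≤ 1 + ε)]
    _ = ENNReal.ofReal (∫ ω, (1 + Y ω ^ (1 + ε)) ∂P) :=
        (ofReal_integral_eq_lintegral_ofReal ((integrable_const 1).add hint) h0).symm
    _ = ENNReal.ofReal (1 + γ) := by
        rw [integral_add (integrable_const 1) hint, hγ]; simp

namespace IntervalModel

variable {Ω : Type*} [MeasurableSpace Ω] {P : Measure Ω} [IsProbabilityMeasure P] {n : ℕ}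
  {X R : Fin n → Ω → ℝ} {L ε γ : ℝ}

/-- With the radii frozen, the bound is a product over `j ∈ T` of functions of distinct independent
radii, so its expectation factors. -/
lemma measure_near_le (hM : IntervalModel P X R L ε γ) (hL : 0 < L) (hε : 0 < ε)
    (T : Finset (Fin n)) {i : Fin n} (hi : i ∉ T) :
    P {ω | ∀ j ∈ T, |X j ω - X i ω| ≤ 2 * R j ω / n} ≤
      ENNReal.ofReal (4 * L * (1 + |γ|) / n) ^ T.card := by
  have hA : MeasurableSet {p : (Fin n → ℝ) × (Fin n → ℝ) |
      ∀ j ∈ T, |p.1 j - p.1 i| ≤ 2 * p.2 j / n} := by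
    simp only [Set.ofPred_forall]
    refine Finset.measurableSet_biInter _ fun j _ => ?_
    exact measurableSet_le (by fun_prop) (by fun_prop)
  have h1 := measure_mem_eq_lintegral_of_indepFun (measurable_pi_lambda _ hM.measurable_center)
    (measurable_pi_lambda _ hM.measurable_radius) hM.indep_center_radius hA
  simp only [Set.mem_ofPred_eq] at h1
  rw [h1]
  have hm (j : Fin n) : Measurable fun x : ℝ => ENNReal.ofReal (2 * L * (2 * x / n)) := by
    fun_prop
  calc _ ≤ ∫⁻ ω, ∏ j ∈ T, ENNReal.ofReal (2 * L * (2 * R j ω / n)) ∂P :=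
        lintegral_mono fun ω => _root_.measure_near_le hM.measurable_center hM.indep_center
          hL.le hM.cdf_lipschitz T hi fun j => 2 * R j ω / n
    _ = ∏ j ∈ T, ∫⁻ ω, ENNReal.ofReal (2 * L * (2 * R j ω / n)) ∂P :=
        lintegral_prod_eq_prod_lintegral_of_indepFun T _ (hM.indep_radius.comp _ hm)
          fun j => (hm j).comp (hM.measurable_radius j)
    _ ≤ ∏ j ∈ T, ENNReal.ofReal (4 * L * (1 + |γ|) / n) := by
        refine Finset.prod_le_prod' fun j _ => ?_
        have hc : 0 ≤ 4 * L / (n : ℝ) := by positivity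
        have h2 (ω : Ω) : ENNReal.ofReal (2 * L * (2 * R j ω / n)) =
            ENNReal.ofReal (4 * L / n) * ENNReal.ofReal (R j ω) := by
          rw [← ENNReal.ofReal_mul hc]; congr 1; ring
        simp only [h2]
        rw [lintegral_const_mul _ (hM.measurable_radius j).ennreal_ofReal]
        calc _ ≤ ENNReal.ofReal (4 * L / n) * ENNReal.ofReal (1 + γ) := by
              refine mul_le_mul_right ?_ _
              exact lintegral_ofReal_le_of_moment hε (hM.radius_nonneg j)
                (hM.integrable_moment j) (hM.moment_eq j)
          _ = ENNReal.ofReal (4 * L / n * (1 + γ)) := (ENNReal.ofReal_mul hc).symm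
          _ ≤ _ := by
              refine ENNReal.ofReal_le_ofReal ?_
              rw [mul_div_right_comm (4 * L) (1 + |γ|)]
              gcongr
              exact le_abs_self γ
    _ = _ := by simp

/-- First moment bound on the number of cliques with `m + 1` vertices. -/
lemma measureReal_succ_le_fgklaOmega_le (hM : IntervalModel P X R L ε γ) (hL : 0 < L)
    (hε : 0 < ε) (m : ℕ) :
    P.real {ω | m + 1 ≤ fgklaOmega (X · ω) (R · ω)} ≤ n * (4 * L * (1 + |γ|)) ^ m / m.factorial := by
  set C := 4 * L * (1 + |γ|) with hC
  have hC0 : 0 ≤ C := by positivity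
  have hq : 0 ≤ C / n := by positivity
  have h1 : P {ω | m + 1 ≤ fgklaOmega (X · ω) (R · ω)} ≤
      ∑ S ∈ (Finset.univ : Finset (Fin n)).powersetCard (m + 1), ∑ i ∈ S,
        P {ω | ∀ j ∈ S.erase i, |X j ω - X i ω| ≤ 2 * R j ω / n} := by
    refine (measure_mono fun ω hω => ?_).trans ((measure_biUnion_finset_le
      ((Finset.univ : Finset (Fin n)).powersetCard (m + 1)) fun S => ⋃ i ∈ S,
        {ω | ∀ j ∈ S.erase i, |X j ω - X i ω| ≤ 2 * R j ω / n}).trans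
          (Finset.sum_le_sum fun S _ => measure_biUnion_finset_le _ _))
    obtain ⟨S, hS, i, hi, h⟩ := exists_near_of_le_fgklaOmega hω
    exact Set.mem_biUnion hS (Set.mem_biUnion hi h)
  have h2 : P {ω | m + 1 ≤ fgklaOmega (X · ω) (R · ω)} ≤
      ENNReal.ofReal (n.choose (m + 1) * ((m + 1) * (C / n) ^ m)) := by
    refine h1.trans ?_
    calc _ ≤ ∑ S ∈ (Finset.univ : Finset (Fin n)).powersetCard (m + 1), ∑ i ∈ S,
          ENNReal.ofReal ((C / n) ^ m) := by
          refine Finset.sum_le_sum fun S hS => Finset.sum_le_sum fun i hi => ?_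
          refine (hM.measure_near_le hL hε _ (Finset.notMem_erase i S)).trans_eq ?_
          rw [Finset.card_erase_of_mem hi, (Finset.mem_powersetCard.1 hS).2,
            Nat.add_sub_cancel, ENNReal.ofReal_pow hq]
      _ = ∑ S ∈ (Finset.univ : Finset (Fin n)).powersetCard (m + 1),
          ENNReal.ofReal ((m + 1) * (C / n) ^ m) := by
          refine Finset.sum_congr rfl fun S hS => ?_
          rw [Finset.sum_const, (Finset.mem_powersetCard.1 hS).2, nsmul_eq_mul,
            ENNReal.ofReal_mul (by positivity)]
          congr 1
          rw [← Nat.cast_succ, ENNReal.ofReal_natCast]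
      _ = _ := by
          rw [Finset.sum_const, Finset.card_powersetCard, Finset.card_univ, Fintype.card_fin,
            nsmul_eq_mul, ENNReal.ofReal_mul (Nat.cast_nonneg _), ENNReal.ofReal_natCast]
  have h3 := ENNReal.toReal_mono ENNReal.ofReal_ne_top h2
  rw [ENNReal.toReal_ofReal (by positivity)] at h3
  refine h3.trans ?_
  rcases Nat.eq_zero_or_pos n with rfl | hn
  · simp
  have hn' : (0 : ℝ) < n := by exact_mod_cast hn
  have h4 : (n.choose (m + 1) : ℝ) ≤ (n : ℝ) ^ (m + 1) / (m + 1).factorial := Nat.choose_le_pow_div _ _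
  calc _ ≤ (n : ℝ) ^ (m + 1) / (m + 1).factorial * ((m + 1) * (C / n) ^ m) := by gcongr
    _ = _ := by
      rw [Nat.factorial_succ, div_pow]; push_cast; field_simp; ring

end IntervalModel

/-! ### Asymptotic estimates -/

/-- Rankin's trick: `x ^ m ≤ (x / y) ^ K * y ^ m` for `m ≥ K`, with `y` left free to optimize. -/
lemma sum_Ico_pow_div_factorial_le {x y : ℝ} (hx : 0 ≤ x) (hy : 0 < y) (hxy : x ≤ y)
    (K n : ℕ) :
    ∑ m ∈ Finset.Ico K n, x ^ m / m.factorial ≤ (x / y) ^ K * Real.exp y := by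
  have hq : 0 ≤ x / y := by positivity
  have hq1 : x / y ≤ 1 := div_le_one_of_le₀ hxy hy.le
  calc _ ≤ ∑ m ∈ Finset.Ico K n, (x / y) ^ K * (y ^ m / m.factorial) := by
        refine Finset.sum_le_sum fun m hm => ?_
        rw [← mul_div_assoc]
        gcongr
        calc x ^ m = (x / y) ^ m * y ^ m := by rw [← mul_pow, div_mul_cancel₀ x hy.ne']
          _ ≤ _ := by
            gcongr ?_ * _
            exact pow_le_pow_of_le_one hq hq1 (Finset.mem_Ico.1 hm).1
    _ = (x / y) ^ K * ∑ m ∈ Finset.Ico K n, y ^ m / m.factorial := by rw [Finset.mul_sum]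
    _ ≤ (x / y) ^ K * ∑ m ∈ Finset.range n, y ^ m / m.factorial := by
        gcongr
        rw [Finset.range_eq_Ico]
        exact Finset.Ico_subset_Ico_left (Nat.zero_le K)
    _ ≤ _ := by
        gcongr
        exact Real.sum_le_exp_of_nonneg hy.le n

lemma tendsto_log_natCast_atTop : Tendsto (fun n : ℕ => Real.log n) atTop atTop :=
  Real.tendsto_log_atTop.comp tendsto_natCast_atTop_atTop

lemma tendsto_log_log_natCast_atTop : Tendsto (fun n : ℕ => Real.log (Real.log n)) atTop atTop :=
  Real.tendsto_log_atTop.comp tendsto_log_natCast_atTop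

/-- The factor `13 / 10` must beat the cost `1 + 1 / 10` of `n * exp (log n / 10)`, yet stay below
`1 / log 2` and `3 / 2` for the two bounds of (a). -/
lemma eventually_sum_Ico_pow_div_factorial_le_one {C : ℝ} (hC : 0 < C) :
    ∀ᶠ n : ℕ in atTop, ∀ K : ℕ, 13 / 10 * (Real.log n / Real.log (Real.log n)) ≤ K →
      ∑ m ∈ Finset.Ico K n, 2 ^ (m + 1) * (n * C ^ m / m.factorial) ≤ 1 := by
  filter_upwards [tendsto_log_natCast_atTop.eventually_ge_atTop (20 * C),
    tendsto_log_natCast_atTop.eventually_ge_atTop 10,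
    tendsto_log_log_natCast_atTop.eventually_ge_atTop (100 * |Real.log (20 * C)|),
    tendsto_log_log_natCast_atTop.eventually_ge_atTop 1, eventually_gt_atTop 0]
    with n h1 h2 h3 h4 hn K hK
  have hn' : (0 : ℝ) < n := by exact_mod_cast hn
  set l := Real.log n
  set ll := Real.log l
  set D := Real.log (20 * C)
  have hl : 0 < l := by linarith
  have hll : 0 < ll := by linarith
  have h5 := sum_Ico_pow_div_factorial_le (x := 2 * C) (y := l / 10) (by positivity)
    (by positivity) (by linarith) K n
  have h6 : 2 * C / (l / 10) = Real.exp (D - ll) := by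
    rw [Real.exp_sub, Real.exp_log (by positivity), Real.exp_log hl]; field_simp; ring
  have hD : D ≤ ll / 100 := by linarith [le_abs_self D]
  have h7 : 1.287 * l ≤ K * (ll - D) := by
    have hA : l / ll * ll = l := div_mul_cancel₀ l hll.ne'
    have hA0 : 0 ≤ l / ll := by positivity
    calc 1.287 * l = 13 / 10 * (l / ll) * (99 / 100 * ll) := by linear_combination -1.287 * hA
      _ ≤ K * (ll - D) := by gcongr; linarith
  calc _ = 2 * n * ∑ m ∈ Finset.Ico K n, (2 * C) ^ m / m.factorial := by
        rw [Finset.mul_sum]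
        refine Finset.sum_congr rfl fun m _ => ?_
        rw [mul_pow]; ring
    _ ≤ 2 * n * ((2 * C / (l / 10)) ^ K * Real.exp (l / 10)) := by gcongr
    _ = 2 * Real.exp (l + (K * (D - ll) + l / 10)) := by
        rw [h6, ← Real.exp_nat_mul, ← Real.exp_add, mul_assoc, Real.exp_add l, Real.exp_log hn']
    _ ≤ Real.exp 1 * Real.exp (l + (K * (D - ll) + l / 10)) := by
        gcongr
        linarith [Real.add_one_le_exp 1]
    _ ≤ 1 := by
        -- The exponent is at most `1 + (1 + 0.1 - 1.287) * l`, negative since `l ≥ 10`.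
        rw [← Real.exp_add, Real.exp_le_one_iff]
        linarith

lemma eventually_mul_pow_div_factorial_le {C δ : ℝ} (hC : 0 < C) (hδ : 0 < δ) :
    ∀ᶠ n : ℕ in atTop, ∀ m : ℕ, δ * n ≤ m + 1 →
      n * C ^ m / m.factorial ≤ Real.exp (-(n : ℝ) * Real.log (Real.log n)) := by
  have hsmall : ∀ᶠ n : ℕ in atTop, Real.log (Real.log n) ≤ δ / 2 * Real.log n := by
    have := (Real.isLittleO_log_id_atTop.comp_tendsto tendsto_log_natCast_atTop).bound
      (show 0 < δ / 2 by positivity)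
    filter_upwards [this, tendsto_log_natCast_atTop.eventually_ge_atTop 0] with n h1 h2
    simp only [Function.comp_apply, id_eq, Real.norm_eq_abs, abs_of_nonneg h2] at h1
    exact (le_abs_self _).trans h1
  filter_upwards [hsmall,
    tendsto_log_natCast_atTop.eventually_ge_atTop (Real.log C),
    tendsto_log_natCast_atTop.eventually_ge_atTop
      ((3 + |Real.log C| + δ * |Real.log C|) / (δ / 2)),
    eventually_gt_atTop 0] with n h1 h2 h3 hn m hm
  have hn' : (0 : ℝ) < n := by exact_mod_cast hn
  have hn1 : (1 : ℝ) ≤ n := by exact_mod_cast hn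
  rw [div_le_iff₀ (by positivity)] at h3
  have hln : Real.log n ≤ n - 1 := Real.log_le_sub_one_of_pos hn'
  -- This replaces Stirling: `m!` is at least `n ^ m / exp n`, leaving the exponent `l + m * (c - l)
  -- + n`, linear in `m`.
  have h4 : (n : ℝ) ^ m / m.factorial ≤ Real.exp n := Real.pow_div_factorial_le_exp n hn'.le m
  set c := Real.log C
  set l := Real.log n
  have h5 : C ^ m = Real.exp (m * (c - l)) * (n : ℝ) ^ m := by
    rw [Real.exp_nat_mul, Real.exp_sub, Real.exp_log hC, Real.exp_log hn', ← mul_pow,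
      div_mul_cancel₀ _ hn'.ne']
  calc n * C ^ m / m.factorial = n * Real.exp (m * (c - l)) * ((n : ℝ) ^ m / m.factorial) := by
        rw [h5]; ring
    _ ≤ n * Real.exp (m * (c - l)) * Real.exp n := by gcongr
    _ = Real.exp (l + m * (c - l) + n) := by
        rw [Real.exp_add, Real.exp_add, Real.exp_log hn']
    _ ≤ _ := by
        refine Real.exp_le_exp.2 ?_
        have h6 : m * (c - l) ≤ (δ * n - 1) * (c - l) :=
          mul_le_mul_of_nonpos_right (by linarith) (by linarith)
        have h7 : n * Real.log l ≤ n * (δ / 2 * l) := by gcongr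
        have h8 : n * (3 + |c| + δ * |c|) ≤ n * (l * (δ / 2)) := by gcongr
        have h9 : δ * n * c ≤ δ * n * |c| := by gcongr; exact le_abs_self c
        have h10 : |c| ≤ n * |c| := le_mul_of_one_le_left (abs_nonneg c) hn1
        have h11 := neg_abs_le c
        nlinarith

lemma two_pow_ceil_le {n : ℕ} (hn : 0 < n) (h : 0 ≤ Real.log n / Real.log (Real.log n)) :
    (2 : ℝ) ^ ⌈13 / 10 * (Real.log n / Real.log (Real.log n))⌉₊ ≤
      2 * (n : ℝ) ^ (1 / Real.log (Real.log n)) := by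
  have hn' : (0 : ℝ) < n := by exact_mod_cast hn
  set A := Real.log n / Real.log (Real.log n)
  have h1 := (Nat.ceil_lt_add_one (by positivity : 0 ≤ 13 / 10 * A)).le
  have h2 : (n : ℝ) ^ (1 / Real.log (Real.log n)) = Real.exp A := by
    rw [Real.rpow_def_of_pos hn', mul_one_div]
  calc (2 : ℝ) ^ ⌈13 / 10 * A⌉₊ = (2 : ℝ) ^ ((⌈13 / 10 * A⌉₊ : ℕ) : ℝ) :=
        (Real.rpow_natCast _ _).symm
    _ ≤ (2 : ℝ) ^ (13 / 10 * A + 1) := Real.rpow_le_rpow_of_exponent_le one_le_two h1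
    _ = Real.exp (Real.log 2 * (13 / 10 * A)) * 2 := by
        rw [Real.rpow_add_one two_ne_zero, Real.rpow_def_of_pos two_pos]
    _ ≤ Real.exp A * 2 := by
        gcongr
        nlinarith [Real.log_two_lt_d9]
    _ = _ := by rw [h2, mul_comm]

/-! ### From tails to expectations, and conclusion -/

/-- When `W > K`, the single term `m = W - 1` already equals `2 ^ W ≥ f W`. Taking `f k = 2 ^ k` and
`f k = k` lets one tail estimate serve both expectations. -/
lemma integral_le_add_sum_two_pow {Ω : Type*} [MeasurableSpace Ω] {P : Measure Ω}
    [IsProbabilityMeasure P] {W : Ω → ℕ} (hW : Measurable W) {n : ℕ} (hWn : ∀ ω, W ω ≤ n)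
    {f : ℕ → ℝ} (hf : Monotone f) (hf0 : ∀ k, 0 ≤ f k) (hf2 : ∀ k, f k ≤ 2 ^ k) (K : ℕ) :
    Integrable (fun ω => f (W ω)) P ∧ ∫ ω, f (W ω) ∂P ≤
      f K + ∑ m ∈ Finset.Ico K n, 2 ^ (m + 1) * P.real {ω | m + 1 ≤ W ω} := by
  have hint : Integrable (fun ω => f (W ω)) P := by
    refine Integrable.of_bound ((measurable_from_nat.comp hW).aestronglyMeasurable) (f n)
      (ae_of_all _ fun ω => ?_)
    rw [Real.norm_of_nonneg (hf0 _)]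
    exact hf (hWn ω)
  have hms (m : ℕ) : MeasurableSet {ω | m + 1 ≤ W ω} := measurableSet_le measurable_const hW
  have hind (m : ℕ) : Integrable ({ω | m + 1 ≤ W ω}.indicator fun _ => (2 : ℝ) ^ (m + 1)) P :=
    (integrable_const _).indicator (hms m)
  refine ⟨hint, ?_⟩
  calc ∫ ω, f (W ω) ∂P ≤ ∫ ω, (f K + ∑ m ∈ Finset.Ico K n,
        {ω | m + 1 ≤ W ω}.indicator (fun _ => (2 : ℝ) ^ (m + 1)) ω) ∂P := by
        refine integral_mono hint
          ((integrable_const _).add (integrable_finsetSum _ fun m _ => hind m)) fun ω => ?_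
        have hnn : ∀ m ∈ Finset.Ico K n,
            0 ≤ {ω | m + 1 ≤ W ω}.indicator (fun _ => (2 : ℝ) ^ (m + 1)) ω := fun m _ =>
          Set.indicator_nonneg (fun _ _ => by positivity) ω
        rcases le_or_gt (W ω) K with h | h
        · exact (hf h).trans (le_add_of_nonneg_right (Finset.sum_nonneg hnn))
        · obtain ⟨m, hm⟩ : ∃ m, W ω = m + 1 := ⟨W ω - 1, by omega⟩
          have hmem : m ∈ Finset.Ico K n := Finset.mem_Ico.2 ⟨by omega, by have := hWn ω; omega⟩
          have := Finset.single_le_sum hnn hmem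
          rw [Set.indicator_of_mem (show ω ∈ {ω | m + 1 ≤ W ω} from hm.ge)] at this
          have h2 := hf2 (W ω)
          rw [hm] at h2
          have := hf0 K
          simp only [hm]
          linarith
    _ = _ := by
        rw [integral_add (integrable_const _) (integrable_finsetSum _ fun m _ => hind m),
          integral_finsetSum _ fun m _ => hind m]
        simp only [integral_const, probReal_univ, one_smul]
        congr 1
        refine Finset.sum_congr rfl fun m _ => ?_
        rw [integral_indicator_const _ (hms m), smul_eq_mul, mul_comm]

theorem mainTheorem2 (L ε γ : ℝ) (hL : 0 < L) (hε : 0 < ε) (hε1 : ε ≤ 1) :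
    (∃ n₀ : ℕ, ∀ n : ℕ, n₀ ≤ n →
      ∀ {Ω : Type*} [MeasurableSpace Ω] (P : Measure Ω) [IsProbabilityMeasure P]
        (X R : Fin n → Ω → ℝ), IntervalModel P X R L ε γ →
        (Integrable (fun ω => (2 : ℝ) ^ fgklaOmega (X · ω) (R · ω)) P ∧
          ∫ ω, (2 : ℝ) ^ fgklaOmega (X · ω) (R · ω) ∂P
            ≤ 1 + 2 * (n : ℝ) ^ (1 / Real.log (Real.log n))) ∧
        (Integrable (fun ω => (fgklaOmega (X · ω) (R · ω) : ℝ)) P ∧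
          ∫ ω, (fgklaOmega (X · ω) (R · ω) : ℝ) ∂P
            ≤ 3 / 2 * (1 + Real.log n / Real.log (Real.log n)))) ∧
    (∀ δ : ℝ, 0 < δ → ∃ n₁ : ℕ, ∀ n : ℕ, n₁ ≤ n →
      ∀ {Ω : Type*} [MeasurableSpace Ω] (P : Measure Ω) [IsProbabilityMeasure P]
        (X R : Fin n → Ω → ℝ), IntervalModel P X R L ε γ →
        P.real {ω | δ * (n : ℝ) ≤ (fgklaOmega (X · ω) (R · ω) : ℝ)}
          ≤ Real.exp (-(n : ℝ) * Real.log (Real.log n))) := by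
  have hC : 0 < 4 * L * (1 + |γ|) := by positivity
  refine ⟨?_, fun δ hδ => ?_⟩
  -- With `A` this ratio, rounding up and the tail give `E ω ≤ 1.3 * A + 2`, which is at most `1.5 *
  -- (1 + A)` once `A ≥ 2.5`.
  · have hA : ∀ᶠ n : ℕ in atTop, 3 ≤ Real.log n / Real.log (Real.log n) := by
      have := (Real.isLittleO_log_id_atTop.comp_tendsto tendsto_log_natCast_atTop).bound
        (show (0 : ℝ) < 1 / 3 by norm_num)
      filter_upwards [this, tendsto_log_natCast_atTop.eventually_ge_atTop 0,
        tendsto_log_log_natCast_atTop.eventually_gt_atTop 0] with n h1 h2 h3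
      simp only [Function.comp_apply, id_eq, Real.norm_eq_abs, abs_of_nonneg h2,
        abs_of_pos h3] at h1
      rw [le_div_iff₀ h3]
      linarith
    obtain ⟨n₀, hn₀⟩ := eventually_atTop.1 ((eventually_sum_Ico_pow_div_factorial_le_one hC).and
      (hA.and (eventually_gt_atTop 0)))
    refine ⟨n₀, fun n hn Ω _ P _ X R hM => ?_⟩
    obtain ⟨htail, hA, hpos⟩ := hn₀ n hn
    have hW := measurable_fgklaOmega hM.measurable_center hM.measurable_radius
    set K := ⌈13 / 10 * (Real.log n / Real.log (Real.log n))⌉₊ with hK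
    have htail' : ∑ m ∈ Finset.Ico K n,
        2 ^ (m + 1) * P.real {ω | m + 1 ≤ fgklaOmega (X · ω) (R · ω)} ≤ 1 :=
      (Finset.sum_le_sum fun m _ => by
        gcongr; exact hM.measureReal_succ_le_fgklaOmega_le hL hε m).trans
          (htail K (Nat.le_ceil _))
    have hbound := fun ω => fgklaOmega_le (X · ω) (R · ω)
    obtain ⟨hint2, hle2⟩ := integral_le_add_sum_two_pow (P := P) hW hbound
      (f := fun k => (2 : ℝ) ^ k) (pow_right_mono₀ one_le_two) (fun k => by positivity)
      (fun k => le_rfl) K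
    obtain ⟨hint1, hle1⟩ := integral_le_add_sum_two_pow (P := P) hW hbound
      (f := fun k => (k : ℝ)) Nat.mono_cast (fun k => by positivity)
      (fun k => by exact_mod_cast k.lt_two_pow_self.le) K
    refine ⟨⟨hint2, ?_⟩, hint1, ?_⟩
    · have := two_pow_ceil_le hpos (by linarith)
      linarith
    · have := (Nat.ceil_lt_add_one
        (by linarith : 0 ≤ 13 / 10 * (Real.log n / Real.log (Real.log n)))).le
      linarith
  · obtain ⟨n₁, hn₁⟩ := eventually_atTop.1 ((eventually_mul_pow_div_factorial_le hC hδ).and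
      (eventually_gt_atTop 0))
    refine ⟨n₁, fun n hn Ω _ P _ X R hM => ?_⟩
    obtain ⟨h, hpos⟩ := hn₁ n hn
    have hδn : 0 < δ * n := by positivity
    obtain ⟨m, hm⟩ : ∃ m, ⌈δ * n⌉₊ = m + 1 :=
      ⟨⌈δ * n⌉₊ - 1, by have := Nat.ceil_pos.2 hδn; omega⟩
    refine le_trans ?_ (h m (by exact_mod_cast hm ▸ Nat.le_ceil (δ * n)))
    refine le_trans (measureReal_mono fun ω hω => ?_)
      (hM.measureReal_succ_le_fgklaOmega_le hL hε m)
    exact hm ▸ Nat.ceil_le.2 hω
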